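/- **Theorem 1.** Let $\log$ denote the continuous branch of the logarithm on $\{z\neq 0:\operatorname{Im} z\ge 0\}$ with $\log i=i\pi/2$. Let $a>0$ and let $c_{nk}$ ($n\ge 1$, $k\ge 0$) be real numbers. Put $\Phi_n(z)=\sum_{k=0}^\infty c_{nk}z^k$ and $$f(z)=\frac{-2\pi}{a\log z}\Bigl(1+\sum_{n=1}^{\infty}\frac{\Phi_n(z)}{\log^n z}\Bigr),\qquad f(0)=0 .$$ Assume that this representation is admissible, that is: (i) the numbers $|c_{nk}|^{1/k}$, $n\ge 1$, $k\ge 1$, are bounded; (ii) there are $M$ and $r>0$ such that $|\Phi_n(z)|^{1/n}\le M$ for all $n\ge 1$ and all $z$ with $\operatorname{Im} z\ge 0$, $|z|<r$; (iii) there are $M$ and $r>0$ such that $\bigl|\sum_{k=1}^\infty k\,c_{nk}z^{k-1}\bigr|^{1/n}\le M$ for all $n\ge 1$ and all $z$ with $\operatorname{Im} z\ge 0$, $|z|<r$; (iv) $c_{10}\ne 0$. Let $D\subset\mathbb C$ be a simply connected domain with a cusp at $0$ whose boundary arcs are $[0,\varepsilon]\subset\mathbb R$ and $\Gamma[-\varepsilon,0]=\{f(x):-\varepsilon\le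 x\le 0\}$ for some $\varepsilon>0$. This means that for every $\delta\in(0,\varepsilon]$ the sets $\partial D$ and $[0,\delta]\cup f([-\delta,0])$ coincide in a neighbourhood of $0$, and that the interior angle of $D$ at $0$ vanishes, i.e. $\arg w\to 0$ as $w\to 0$, $w\in D$ (with the principal value of $\arg$). Let $g$ be a conformal map of $\mathbb H=\{z:\operatorname{Im} z>0\}$ onto $D$ with $g(0)=0$, i.e. $g(z)\to 0$ as $z\to 0$, $z\in\mathbb H$. Then $$\lim_{z\to 0,\ \operatorname{Im} z>0} g(z)\left(-\frac{2\pi}{a\log|z|}\right)^{-1}=1 .$$ -/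

import Mathlib

noncomputable section

/-- The power series `Φ_n(z) = ∑_{k ≥ 0} c_{nk} z ^ k` with real coefficients. -/
def cuspPhi (c : ℕ → ℕ → ℝ) (n : ℕ) (z : ℂ) : ℂ :=
  ∑' k : ℕ, (c n k : ℂ) * z ^ k

/-- The termwise derivative `∑_{k ≥ 1} k c_{nk} z ^ (k - 1)` of `Φ_n`. -/
def cuspPhiDeriv (c : ℕ → ℕ → ℝ) (n : ℕ) (z : ℂ) : ℂ :=
  ∑' k : ℕ, ((k : ℂ) + 1) * (c n (k + 1) : ℂ) * z ^ k

/-- The generalized power series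
`f(z) = -2π / (a log z) * (1 + ∑_{n ≥ 1} Φ_n(z) / (log z) ^ n)`.
On the closed upper half-plane without `0` the principal branch `Complex.log` is the continuous
branch with `log i = iπ/2` (in particular `log x = log |x| + iπ` for real `x < 0`).
The value at `z = 0` is `0`, which is also the limit of `f` there when the series is admissible.
Only the coefficients `c n k` with `n ≥ 1` are used. -/
def cuspSeries (a : ℝ) (c : ℕ → ℕ → ℝ) (z : ℂ) : ℂ :=
  (-2 * (Real.pi : ℂ)) / ((a : ℂ) * Complex.log z) *
    (1 + ∑' n : ℕ, cuspPhi c (n + 1) z / Complex.log z ^ (n + 1))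

/-- Admissibility of the representation `cuspSeries a c`. -/
structure IsAdmissible (a : ℝ) (c : ℕ → ℕ → ℝ) : Prop where
  a_pos : 0 < a
  /-- The `k`-th roots of the `|c_{nk}|` are bounded, uniformly in `n` and `k`. -/
  coeff_bound : ∃ M : ℝ, ∀ n k : ℕ, 1 ≤ n → 1 ≤ k → |c n k| ^ (1 / (k : ℝ)) ≤ M
  /-- The `n`-th roots of the `|Φ_n(z)|` are bounded, uniformly in `n`, for `|z|` small. -/
  phi_bound : ∃ M : ℝ, ∃ r > 0, ∀ n : ℕ, 1 ≤ n → ∀ z : ℂ, 0 ≤ z.im → ‖z‖ < r →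
    ‖cuspPhi c n z‖ ^ (1 / (n : ℝ)) ≤ M
  /-- The same for the derivatives of the `Φ_n`. -/
  phiDeriv_bound : ∃ M : ℝ, ∃ r > 0, ∀ n : ℕ, 1 ≤ n → ∀ z : ℂ, 0 ≤ z.im → ‖z‖ < r →
    ‖cuspPhiDeriv c n z‖ ^ (1 / (n : ℝ)) ≤ M
  c_one_zero_ne : c 1 0 ≠ 0

/-- The real segment `[0, δ]` in the complex plane. -/
def cuspSegment (δ : ℝ) : Set ℂ := (fun x : ℝ => (x : ℂ)) '' Set.Icc 0 δ

/-- The curve `Γ[-δ, 0]`, the image of the parameter interval `[-δ, 0]` under `cuspSeries a c`. -/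
def cuspCurve (a : ℝ) (c : ℕ → ℕ → ℝ) (δ : ℝ) : Set ℂ :=
  (fun x : ℝ => cuspSeries a c (x : ℂ)) '' Set.Icc (-δ) 0

/-- `D` has at `0` a cusp with the two boundary arcs `[0, ε]` and `Γ[-ε, 0]`. -/
structure HasCuspAtZero (D : Set ℂ) (a : ℝ) (c : ℕ → ℕ → ℝ) (ε : ℝ) : Prop where
  /-- At `0` the boundary of `D` consists of the two arcs. (For each subarc with endpoint `0` it
  is again true that the boundary consists of the subarcs near `0`: the remote parts of the arcs
  do not come back to `0`.) -/
  frontier_eq : ∀ δ : ℝ, 0 < δ → δ ≤ ε → ∃ r > 0,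
    frontier D ∩ Metric.ball 0 r = (cuspSegment δ ∪ cuspCurve a c δ) ∩ Metric.ball 0 r
  /-- The interior angle of `D` at `0` vanishes: seen from `0`, the points of `D` near `0` lie
  in arbitrarily thin sectors around the tangent direction of the arcs. -/
  angle_eq_zero : Filter.Tendsto Complex.arg (nhdsWithin 0 D) (nhds 0)

/-- `g` is a conformal map of `U` onto `D`. -/
structure IsConformalMapOnto (g : ℂ → ℂ) (U D : Set ℂ) : Prop where
  differentiableOn : DifferentiableOn ℂ g U
  bijOn : Set.BijOn g U D

end

open Complex Filter Topology Set MeasureTheory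

/-! In the coordinate `s = log z` the series becomes `cuspMap a H s`, that is `-2π / (a H(s))`,
where `H` differs from the identity by at most a constant far to the left and is injective there
(`IsAdmissible.exists_chart`). Since the coefficients are real, `H` commutes with conjugation, so
the segment can only come from the line `im s = 0`, while the curve comes from `im s = π`. The zero
angle rules out everything outside the strip between these lines, so near the cusp `D` is the image
of a half-strip of height `π` (`HasCuspAtZero.exists_halfStrip`).

Lifting `g` through this map gives `S` with values in the half-strip, so `exp ∘ S` maps a half-disc
at `0` into the upper half-plane (`IsConformalMapOnto.exists_log_factor`). Its imaginary part tends
to `0` at the diameter, so it extends holomorphically across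
(`exists_differentiableOn_ball_of_tendsto_im`). The extension vanishes at `0`, and only to first
order because it preserves the upper half-plane (`exists_eq_mul_of_im_pos`). Hence `re S = log |z| +
O(1)`; as `im S` and `H - id` are bounded, `H(S(z)) = log |z| + O(1)`, and `g(z) = -2π / (a
H(S(z)))` has the stated asymptotics. -/

/-! ### Estimates for the power series `Φ_n`. -/

/-- Geometric bounds for the coefficients of an admissible series. -/
theorem IsAdmissible.exists_coeff_bound {a : ℝ} {c : ℕ → ℕ → ℝ} (h : IsAdmissible a c) :
    ∃ N : ℝ, 1 ≤ N ∧ (∀ n, 1 ≤ n → |c n 0| ≤ N ^ n) ∧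
      ∀ n k, 1 ≤ n → 1 ≤ k → |c n k| ≤ N ^ k := by
  obtain ⟨M₁, h₁⟩ := h.coeff_bound
  obtain ⟨M₂, r, hr, h₂⟩ := h.phi_bound
  -- The second alternative carries the side condition on `M`, so that one statement serves both
  -- `M₁` and `M₂`. The `k = 0` coefficient is not covered by `coeff_bound`; it is read off from
  -- `Φ_n(0)`.
  have key : ∀ (M x : ℝ) (m : ℕ), 1 ≤ m → 0 ≤ x → x ^ (1 / (m : ℝ)) ≤ M →
      x ≤ (max 1 (max M₁ M₂)) ^ m ∨ ¬ M ≤ max M₁ M₂ := by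
    intro M x m hm hx hM
    by_cases hle : M ≤ max M₁ M₂
    · left
      have hm' : m ≠ 0 := by omega
      calc x = (x ^ ((m : ℝ)⁻¹)) ^ m := (Real.rpow_inv_natCast_pow hx hm').symm
        _ ≤ _ := by
          rw [← one_div]
          exact pow_le_pow_left₀ (Real.rpow_nonneg hx _)
            (hM.trans (hle.trans (le_max_right _ _))) m
    · exact Or.inr hle
  refine ⟨max 1 (max M₁ M₂), le_max_left _ _, fun n hn => ?_, fun n k hn hk => ?_⟩
  · have h0 := h₂ n hn 0 (by simp) (by simpa using hr)
    have hphi : cuspPhi c n 0 = c n 0 := by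
      unfold cuspPhi
      rw [tsum_eq_single 0 (fun k hk => by simp [hk])]
      simp
    rw [hphi, norm_real, Real.norm_eq_abs] at h0
    exact (key _ _ n hn (abs_nonneg _) h0).resolve_right (fun h => h (le_max_right _ _))
  · exact (key _ _ k hk (abs_nonneg _) (h₁ n k hn hk)).resolve_right
      (fun h => h (le_max_left _ _))

theorem norm_cuspPhi_term_le {c : ℕ → ℕ → ℝ} {N : ℝ} (hN : 1 ≤ N)
    (h0 : ∀ n, 1 ≤ n → |c n 0| ≤ N ^ n) (h1 : ∀ n k, 1 ≤ n → 1 ≤ k → |c n k| ≤ N ^ k)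
    {n : ℕ} (hn : 1 ≤ n) {z : ℂ} (hz : ‖z‖ ≤ 1 / (2 * N)) (k : ℕ) :
    ‖(c n k : ℂ) * z ^ k‖ ≤ N ^ n * (1 / 2) ^ k := by
  rw [norm_mul, norm_pow, norm_real, Real.norm_eq_abs]
  have hN0 : 0 < N := by linarith
  rcases Nat.eq_zero_or_pos k with rfl | hk
  · simpa using h0 n hn
  · calc |c n k| * ‖z‖ ^ k ≤ N ^ k * (1 / (2 * N)) ^ k := by
          gcongr
          exact h1 n k hn hk
      _ = (1 / 2) ^ k := by
          rw [← mul_pow]; congr 1; field_simp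
      _ ≤ N ^ n * (1 / 2) ^ k := le_mul_of_one_le_left (by positivity) (one_le_pow₀ hN)

theorem norm_cuspPhi_le {c : ℕ → ℕ → ℝ} {N : ℝ} (hN : 1 ≤ N)
    (h0 : ∀ n, 1 ≤ n → |c n 0| ≤ N ^ n) (h1 : ∀ n k, 1 ≤ n → 1 ≤ k → |c n k| ≤ N ^ k)
    {n : ℕ} (hn : 1 ≤ n) {z : ℂ} (hz : ‖z‖ ≤ 1 / (2 * N)) :
    ‖cuspPhi c n z‖ ≤ (2 * N) ^ n := by
  have hsum : HasSum (fun k : ℕ => N ^ n * (1 / 2 : ℝ) ^ k) (N ^ n * 2) :=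
    hasSum_geometric_two.mul_left _
  refine (tsum_of_norm_bounded hsum (norm_cuspPhi_term_le hN h0 h1 hn hz)).trans ?_
  rw [mul_pow, mul_comm]
  -- The factor 2 from the geometric series is absorbed into the `n`-th power, as `n ≥ 1`.
  have : (2 : ℝ) ≤ 2 ^ n := le_self_pow₀ (by norm_num) (by omega)
  gcongr

theorem differentiableOn_cuspPhi {c : ℕ → ℕ → ℝ} {N : ℝ} (hN : 1 ≤ N)
    (h0 : ∀ n, 1 ≤ n → |c n 0| ≤ N ^ n) (h1 : ∀ n k, 1 ≤ n → 1 ≤ k → |c n k| ≤ N ^ k)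
    {n : ℕ} (hn : 1 ≤ n) : DifferentiableOn ℂ (cuspPhi c n) (Metric.ball 0 (1 / (2 * N))) := by
  refine differentiableOn_tsum_of_summable_norm (u := fun k : ℕ => N ^ n * (1 / 2 : ℝ) ^ k)
    (summable_geometric_two.mul_left _) (fun k => by fun_prop) Metric.isOpen_ball ?_
  intro k z hz
  exact norm_cuspPhi_term_le hN h0 h1 hn (by simpa using (mem_ball_zero_iff.1 hz).le) k

/-- The coefficients are real. This is the source of the symmetry of `H` that identifies the
preimage of the real boundary arc. -/
theorem cuspPhi_conj (c : ℕ → ℕ → ℝ) (n : ℕ) (z : ℂ) :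
    cuspPhi c n (starRingEnd ℂ z) = starRingEnd ℂ (cuspPhi c n z) := by
  unfold cuspPhi
  rw [conj_tsum]
  simp

/-! ### Perturbations of the identity in the logarithmic coordinate. -/

/-- A holomorphic function that differs from the identity by a bounded function satisfies a
Lipschitz estimate deep inside a left half-plane. -/
theorem norm_sub_sub_le_half_of_norm_sub_le {H : ℂ → ℂ} {R B : ℝ} (hB : 0 < B)
    (hd : DifferentiableOn ℂ H {s | s.re < -R}) (hb : ∀ s : ℂ, s.re < -R → ‖H s - s‖ ≤ B)
    {s t : ℂ} (hs : s.re < -(R + 3 * B)) (ht : t.re < -(R + 3 * B)) :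
    ‖(H s - s) - (H t - t)‖ ≤ 1 / 2 * ‖s - t‖ := by
  have ho : IsOpen {s : ℂ | s.re < -R} := isOpen_lt continuous_re continuous_const
  have hd' : DifferentiableOn ℂ (fun s => H s - s) {s | s.re < -R} := hd.sub differentiableOn_id
  have hconv : Convex ℝ {s : ℂ | s.re < -(R + 3 * B)} := convex_halfSpace_re_lt _
  refine hconv.norm_image_sub_le_of_norm_deriv_le (f := fun s => H s - s) (𝕜 := ℂ) ?_ ?_ ht hs
  · intro x hx
    refine (hd' x ?_).differentiableAt (ho.mem_nhds ?_) <;>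
    · simp only [mem_ofPred_eq] at hx ⊢; linarith
  · intro x hx
    have hsub : Metric.closedBall x (2 * B) ⊆ {s : ℂ | s.re < -R} := by
      intro y hy
      have h1 : |(y - x).re| ≤ 2 * B :=
        (abs_re_le_norm _).trans (by simpa [dist_eq_norm] using hy)
      have h2 := (abs_le.1 h1).2
      simp only [mem_ofPred_eq, sub_re] at hx h2 ⊢
      linarith
    -- Cauchy's estimate on a circle of radius `2 * B` bounds the derivative by `B / (2 * B)`; the
    -- margin `3 * B` leaves room for this disc.
    have := norm_deriv_le_of_forall_mem_sphere_norm_le (f := fun s => H s - s) (c := x)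
      (R := 2 * B) (C := B) (by positivity)
      ((hd'.mono hsub).diffContOnCl_ball subset_rfl)
      (fun z hz => hb z (hsub (Metric.sphere_subset_closedBall hz)))
    refine this.trans (le_of_eq ?_)
    field_simp

/-- `H` is a holomorphic perturbation of the identity on the half-plane `re s < -R` that commutes
with conjugation: it stays within `B` of the identity, and `H - id` is a contraction. -/
structure IsLogChart (H : ℂ → ℂ) (R B : ℝ) : Prop where
  pos : 0 < B
  lt : B < R
  differentiableOn : DifferentiableOn ℂ H {s | s.re < -R}
  norm_sub_le : ∀ s : ℂ, s.re < -R → ‖H s - s‖ ≤ B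
  lipschitz : ∀ s t : ℂ, s.re < -R → t.re < -R → ‖(H s - s) - (H t - t)‖ ≤ 1 / 2 * ‖s - t‖
  conj : ∀ s : ℂ, s.re < -R → H (starRingEnd ℂ s) = starRingEnd ℂ (H s)

namespace IsLogChart

variable {H : ℂ → ℂ} {R B : ℝ}

theorem mono (h : IsLogChart H R B) {R' : ℝ} (hR : R ≤ R') : IsLogChart H R' B where
  pos := h.pos
  lt := h.lt.trans_le hR
  differentiableOn := h.differentiableOn.mono fun s hs => by
    simp only [mem_ofPred_eq] at hs ⊢; linarith
  norm_sub_le s hs := h.norm_sub_le s (by linarith)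
  lipschitz s t hs ht := h.lipschitz s t (by linarith) (by linarith)
  conj s hs := h.conj s (by linarith)

theorem sub_le_norm (h : IsLogChart H R B) {s : ℂ} (hs : s.re < -R) : ‖s‖ - B ≤ ‖H s‖ := by
  have h1 := norm_sub_norm_le s (H s)
  rw [norm_sub_rev] at h1
  linarith [h.norm_sub_le s hs]

theorem lt_norm (h : IsLogChart H R B) {s : ℂ} (hs : s.re < -R) : R - B < ‖H s‖ := by
  have := (neg_le_abs s.re).trans (abs_re_le_norm s)
  linarith [h.sub_le_norm hs]

theorem ne_zero (h : IsLogChart H R B) {s : ℂ} (hs : s.re < -R) : H s ≠ 0 :=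
  norm_pos_iff.1 (by linarith [h.lt_norm hs, h.lt])

theorem norm_sub_le_two_mul (h : IsLogChart H R B) {s t : ℂ} (hs : s.re < -R) (ht : t.re < -R) :
    ‖s - t‖ ≤ 2 * ‖H s - H t‖ := by
  have h1 := h.lipschitz s t hs ht
  have h2 := _root_.norm_sub_le (H s - H t) ((H s - s) - (H t - t))
  rw [show H s - H t - ((H s - s) - (H t - t)) = s - t by ring] at h2
  linarith

theorem injOn (h : IsLogChart H R B) {s t : ℂ} (hs : s.re < -R) (ht : t.re < -R)
    (hst : H s = H t) : s = t := by
  have := h.norm_sub_le_two_mul hs ht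
  rw [hst, sub_self, norm_zero, mul_zero] at this
  exact sub_eq_zero.1 (norm_le_zero_iff.1 this)

theorem differentiableAt (h : IsLogChart H R B) {s : ℂ} (hs : s.re < -R) :
    DifferentiableAt ℂ H s :=
  h.differentiableOn.differentiableAt ((isOpen_lt continuous_re continuous_const).mem_nhds hs)

/-- At a critical point of `H` the derivative of `H - id` would be `-1`, against the Lipschitz
constant `1 / 2`. -/
theorem deriv_ne_zero (h : IsLogChart H R B) {s : ℂ} (hs : s.re < -R) : deriv H s ≠ 0 := by
  have ho : {s : ℂ | s.re < -R} ∈ 𝓝 s :=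
    (isOpen_lt continuous_re continuous_const).mem_nhds hs
  intro h0
  have hd : HasDerivAt (fun s => H s - s) (0 - 1) s := by
    rw [← h0]
    exact (h.differentiableAt hs).hasDerivAt.sub (hasDerivAt_id s)
  have := hd.le_of_lip' (C := 1 / 2) (by norm_num) (by
    filter_upwards [ho] with t ht using h.lipschitz t s ht hs)
  norm_num at this

/-- Solvability of `H s = ζ`. -/
theorem exists_eq (h : IsLogChart H R B) {ζ : ℂ} (hζ : ζ.re ≤ -(R + 1 + B)) :
    ∃ s : ℂ, s.re < -R ∧ H s = ζ := by
  -- Solutions are the fixed points of `s ↦ ζ - (H s - s)`, a contraction of the closed half-plane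
  -- `K`; the extra `B` in the bound on `ζ` makes it preserve `K`.
  set K : Set ℂ := {s | s.re ≤ -(R + 1)} with hK
  have hKc : IsComplete K := (isClosed_le continuous_re continuous_const).isComplete
  have hKR : ∀ s ∈ K, s.re < -R := fun s hs => by
    simp only [hK, mem_ofPred_eq] at hs; linarith
  have hmaps : MapsTo (fun s => ζ - (H s - s)) K K := by
    intro s hs
    have h1 := (abs_le.1 ((abs_re_le_norm _).trans (h.norm_sub_le s (hKR s hs)))).1
    simp only [hK, mem_ofPred_eq, sub_re] at h1 ⊢
    linarith
  have hcontr : ContractingWith (1 / 2) (hmaps.restrict _ K K) := by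
    refine ⟨by rw [← NNReal.coe_lt_coe]; norm_num, LipschitzWith.of_dist_le_mul ?_⟩
    rintro ⟨s, hs⟩ ⟨t, ht⟩
    simp only [Subtype.dist_eq, MapsTo.val_restrict_apply, dist_eq_norm]
    rw [show ζ - (H s - s) - (ζ - (H t - t)) = -((H s - s) - (H t - t)) by ring, norm_neg]
    simpa using h.lipschitz s t (hKR s hs) (hKR t ht)
  have hx : ((-(R + 1) : ℝ) : ℂ) ∈ K := by simp [hK]
  obtain ⟨y, hy, hfix, -⟩ := hcontr.exists_fixedPoint' hKc hmaps hx (edist_ne_top _ _)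
  refine ⟨y, hKR y hy, ?_⟩
  have : ζ - (H y - y) = y := hfix
  linear_combination -this

end IsLogChart

/-- In the logarithmic coordinate `s = log z` an admissible series is `-2π / (a H(s))`, where `H`
is a holomorphic perturbation of the identity that commutes with conjugation. -/
theorem IsAdmissible.exists_chart {a : ℝ} {c : ℕ → ℕ → ℝ} (hadm : IsAdmissible a c) :
    ∃ (H : ℂ → ℂ) (R B : ℝ), IsLogChart H R B ∧
      ∀ x : ℂ, cuspSeries a c x = -2 * Real.pi / (a * H (Complex.log x)) := by
  obtain ⟨N, hN, h0, h1⟩ := hadm.exists_coeff_bound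
  have hN0 : 0 < N := by linarith
  set q : ℂ → ℂ := fun s => ∑' n : ℕ, cuspPhi c (n + 1) (exp s) / s ^ (n + 1) with hq
  -- The constant `8 * N` gives both `|exp s| < 1 / (2N)`, hence `|Φ_n| ≤ (2N) ^ n`, and `2N / |s| ≤
  -- 1 / 4`. The outer series is then geometric, `|q| ≤ 4N / |s| ≤ 1 / 2`, and `|H s - s| = |s q /
  -- (1 + q)| ≤ 8N`.
  set U : Set ℂ := {s | s.re < -(8 * N)} with hU
  have hUo : IsOpen U := isOpen_lt continuous_re continuous_const
  have hexp : ∀ s ∈ U, ‖exp s‖ < 1 / (2 * N) := by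
    intro s hs
    rw [norm_exp, lt_one_div (Real.exp_pos _) (by positivity), one_div, ← Real.exp_neg]
    have := Real.add_one_le_exp (-s.re)
    simp only [hU, mem_ofPred_eq] at hs
    linarith
  have hnorm : ∀ s ∈ U, 8 * N ≤ ‖s‖ := by
    intro s hs
    have := (neg_le_abs s.re).trans (abs_re_le_norm s)
    simp only [hU, mem_ofPred_eq] at hs
    linarith
  have hterm : ∀ s ∈ U, ∀ n : ℕ,
      ‖cuspPhi c (n + 1) (exp s) / s ^ (n + 1)‖ ≤ 2 * N / ‖s‖ * (1 / 2) ^ n := by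
    intro s hs n
    have hs0 : 0 < ‖s‖ := by linarith [hnorm s hs]
    rw [norm_div, norm_pow]
    calc _ ≤ (2 * N) ^ (n + 1) / ‖s‖ ^ (n + 1) := by
          gcongr
          exact norm_cuspPhi_le hN h0 h1 (by omega) (hexp s hs).le
      _ = 2 * N / ‖s‖ * (2 * N / ‖s‖) ^ n := by rw [← div_pow, pow_succ']
      _ ≤ _ := by
          have : 2 * N / ‖s‖ ≤ 1 / 2 := by
            rw [div_le_iff₀ hs0]
            linarith [hnorm s hs]
          gcongr
  have hqle : ∀ s ∈ U, ‖q s‖ ≤ 4 * N / ‖s‖ := by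
    intro s hs
    refine (tsum_of_norm_bounded (hasSum_geometric_two.mul_left _) (hterm s hs)).trans_eq ?_
    ring
  have hqhalf : ∀ s ∈ U, ‖q s‖ ≤ 1 / 2 := by
    intro s hs
    refine (hqle s hs).trans ?_
    rw [div_le_iff₀ (by linarith [hnorm s hs])]
    linarith [hnorm s hs]
  have hqd : DifferentiableOn ℂ q U := by
    refine differentiableOn_tsum_of_summable_norm (u := fun n : ℕ => 1 / 4 * (1 / 2 : ℝ) ^ n)
      (summable_geometric_two.mul_left _) (fun n s hs => ?_) hUo (fun n s hs => ?_)
    · refine DifferentiableWithinAt.div ?_ (by fun_prop) (pow_ne_zero _ ?_)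
      · have hmem : exp s ∈ Metric.ball (0 : ℂ) (1 / (2 * N)) :=
          mem_ball_zero_iff.2 (hexp s hs)
        exact (((differentiableOn_cuspPhi hN h0 h1 (by omega)).differentiableAt
          (Metric.isOpen_ball.mem_nhds hmem)).comp s
            differentiable_exp.differentiableAt).differentiableWithinAt
      · exact norm_pos_iff.1 (by linarith [hnorm s hs])
    · refine (hterm s hs n).trans ?_
      have : 2 * N / ‖s‖ ≤ 1 / 4 := by
        rw [div_le_iff₀ (by linarith [hnorm s hs])]
        linarith [hnorm s hs]
      gcongr
  have hge : ∀ s ∈ U, 1 / 2 ≤ ‖1 + q s‖ := by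
    intro s hs
    have := norm_sub_le_norm_add (1 : ℂ) (q s)
    rw [norm_one] at this
    linarith [hqhalf s hs]
  have hne : ∀ s ∈ U, 1 + q s ≠ 0 := fun s hs => norm_pos_iff.1 (by linarith [hge s hs])
  set H : ℂ → ℂ := fun s => s / (1 + q s) with hH
  have hHd : DifferentiableOn ℂ H U :=
    differentiableOn_id.div ((differentiableOn_const _).add hqd) hne
  have hHb : ∀ s : ℂ, s.re < -(8 * N) → ‖H s - s‖ ≤ 8 * N := by
    intro s hs
    have hs0 : 0 < ‖s‖ := by linarith [hnorm s hs]
    have : H s - s = -(s * q s) / (1 + q s) := by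
      have := hne s hs
      simp only [hH]
      field_simp
      ring
    rw [this, norm_div, norm_neg, norm_mul, div_le_iff₀ (by linarith [hge s hs])]
    have h2 := hqle s hs
    rw [le_div_iff₀ hs0] at h2
    nlinarith [hge s hs]
  have hmono : ∀ s : ℂ, s.re < -(8 * N + 3 * (8 * N)) → s.re < -(8 * N) := fun s hs => by linarith
  refine ⟨H, 8 * N + 3 * (8 * N), 8 * N, ⟨by positivity, by linarith,
    hHd.mono (fun s hs => hmono s hs), fun s hs => hHb s (hmono s hs),
    fun s t hs ht => norm_sub_sub_le_half_of_norm_sub_le (by positivity) hHd hHb hs ht,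
    fun s _ => ?_⟩, fun x => ?_⟩
  · simp only [hH, hq, map_div₀, map_add, map_one, conj_tsum, map_pow, ← cuspPhi_conj, ← exp_conj]
  -- At `x = 0` both sides vanish, because `log 0 = 0` and division by zero gives zero.
  · rcases eq_or_ne x 0 with rfl | hx
    · simp [cuspSeries, hH]
    · simp only [cuspSeries, hH, hq, exp_log hx]
      rw [mul_div_assoc', div_div_eq_mul_div, div_mul_eq_mul_div]

/-! ### Schwarz reflection. -/

/-- A continuous function on a disc that is holomorphic off the real diameter is holomorphic. -/
theorem differentiableOn_ball_of_differentiableOn_off_real {f : ℂ → ℂ} {r : ℝ}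
    (hf : ContinuousOn f (Metric.ball 0 r))
    (hup : ∀ z ∈ Metric.ball (0 : ℂ) r, 0 < z.im → DifferentiableAt ℂ f z)
    (hlow : ∀ z ∈ Metric.ball (0 : ℂ) r, z.im < 0 → DifferentiableAt ℂ f z) :
    DifferentiableOn ℂ f (Metric.ball 0 r) := by
  refine (IsConservativeOn.isExactOn_ball hf ?_).differentiableOn Metric.isOpen_ball
  -- Morera's theorem: on a rectangle in one closed half, Cauchy's theorem needs holomorphy only in
  -- the open rectangle. A rectangle meeting the real axis is cut along it, and the integrals over
  -- the cut cancel.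
  have half : ∀ z w : ℂ, Rectangle z w ⊆ Metric.ball 0 r →
      (0 ≤ z.im ∧ 0 ≤ w.im ∨ z.im ≤ 0 ∧ w.im ≤ 0) →
      (∫ x : ℝ in z.re..w.re, f (x + z.im * I)) - (∫ x : ℝ in z.re..w.re, f (x + w.im * I)) +
      I • (∫ y : ℝ in z.im..w.im, f (w.re + y * I)) -
      I • (∫ y : ℝ in z.im..w.im, f (z.re + y * I)) = 0 := by
    intro z w hzw hsign
    refine integral_boundary_rect_eq_zero_of_continuousOn_of_differentiableOn f z w (hf.mono hzw) ?_
    intro p hp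
    have hpb : p ∈ Metric.ball (0 : ℂ) r := hzw
      ⟨Ioo_subset_Icc_self hp.1, Ioo_subset_Icc_self hp.2⟩
    obtain ⟨h1, h2⟩ := hp.2
    rcases hsign with ⟨hz, hw⟩ | ⟨hz, hw⟩
    · exact (hup p hpb ((le_min hz hw).trans_lt h1)).differentiableWithinAt
    · exact (hlow p hpb (h2.trans_le (max_le hz hw))).differentiableWithinAt
  intro z w hzw
  rw [← add_eq_zero_iff_eq_neg, wedgeIntegral_add_wedgeIntegral_eq]
  by_cases h0 : (0 : ℝ) ∈ uIcc z.im w.im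
  · have hsub1 : uIcc z.im 0 ⊆ uIcc z.im w.im := uIcc_subset_uIcc left_mem_uIcc h0
    have hsub2 : uIcc 0 w.im ⊆ uIcc z.im w.im := uIcc_subset_uIcc h0 right_mem_uIcc
    have e1 := half z w.re (fun p hp => hzw ⟨by simpa using hp.1, hsub1 (by simpa using hp.2)⟩)
      (by simpa using le_total 0 z.im)
    have e2 := half z.re w (fun p hp => hzw ⟨by simpa using hp.1, hsub2 (by simpa using hp.2)⟩)
      (by simpa using le_total 0 w.im)
    have hint : ∀ x ∈ uIcc z.re w.re, ∀ s t : ℝ, uIcc s t ⊆ uIcc z.im w.im →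
        IntervalIntegrable (fun y : ℝ => f (x + y * I)) volume s t := by
      intro x hx s t hst
      refine ContinuousOn.intervalIntegrable (hf.comp (by fun_prop) ?_)
      intro y hy
      exact hzw ⟨by simpa using hx, by simpa using hst hy⟩
    have e3 := intervalIntegral.integral_add_adjacent_intervals
      (hint w.re right_mem_uIcc _ _ hsub1) (hint w.re right_mem_uIcc _ _ hsub2)
    have e4 := intervalIntegral.integral_add_adjacent_intervals
      (hint z.re left_mem_uIcc _ _ hsub1) (hint z.re left_mem_uIcc _ _ hsub2)
    simp only [ofReal_re, ofReal_im, smul_eq_mul] at e1 e2 ⊢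
    rw [← e3, ← e4]
    linear_combination e1 + e2
  · refine half z w hzw ?_
    rw [mem_uIcc] at h0
    rcases le_total 0 z.im with h | h <;> rcases le_total 0 w.im with h' | h' <;> tauto

/-- Schwarz reflection: a continuous function on a half-disc, real on the diameter and holomorphic
inside, extends holomorphically to the disc. -/
theorem exists_differentiableOn_ball_of_im_eq_zero {Q : ℂ → ℂ} {r : ℝ} (hQ : Continuous Q)
    (hd : ∀ z ∈ Metric.ball (0 : ℂ) r, 0 < z.im → DifferentiableAt ℂ Q z)
    (hre : ∀ x : ℝ, |x| < r → (Q x).im = 0) :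
    ∃ W : ℂ → ℂ, DifferentiableOn ℂ W (Metric.ball 0 r) ∧ ∀ z : ℂ, 0 < z.im → W z = Q z := by
  classical
  set Q' : ℂ → ℂ := starRingEnd ℂ ∘ Q ∘ starRingEnd ℂ with hQ'
  set W : ℂ → ℂ := fun z => if 0 ≤ z.im then Q z else Q' z with hW
  refine ⟨W, differentiableOn_ball_of_differentiableOn_off_real ?_ ?_ ?_,
    fun z hz => if_pos hz.le⟩
  · refine ContinuousOn.if ?_ hQ.continuousOn
      (continuous_conj.comp (hQ.comp continuous_conj)).continuousOn
    rintro z ⟨hz, hfr⟩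
    have him : z.im = 0 := by
      rw [frontier_setOfPred_le_im] at hfr
      exact hfr
    have hz' : z = (z.re : ℂ) := Complex.ext (by simp) (by simpa using him)
    have hr := hre z.re ((abs_re_le_norm z).trans_lt (mem_ball_zero_iff.1 hz))
    rw [hz']
    simp only [hQ', Function.comp_apply, conj_ofReal]
    exact (conj_eq_iff_im.2 hr).symm
  · intro z hz him
    refine (hd z hz him).congr_of_eventuallyEq ?_
    filter_upwards [(isOpen_lt continuous_const continuous_im).mem_nhds him] with y hy
    exact if_pos (le_of_lt hy)
  · intro z hz him
    have h1 := (hd (starRingEnd ℂ z) (by simpa using hz) (by simpa using him)).conj_conj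
    rw [conj_conj] at h1
    refine h1.congr_of_eventuallyEq ?_
    filter_upwards [(isOpen_lt continuous_im continuous_const).mem_nhds him] with y hy
    exact if_neg (not_le.2 hy)

/-- Schwarz reflection for bounded functions whose imaginary part tends to zero at the diameter. -/
theorem exists_differentiableOn_ball_of_tendsto_im {ψ : ℂ → ℂ} {r M : ℝ}
    (hd : DifferentiableOn ℂ ψ ({z | 0 < z.im} ∩ Metric.ball 0 r))
    (hM : ∀ z ∈ {z : ℂ | 0 < z.im} ∩ Metric.ball 0 r, ‖ψ z‖ ≤ M)
    (him : ∀ x : ℝ, |x| < r →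
      Tendsto (fun z => (ψ z).im) (𝓝[{z | 0 < z.im}] (x : ℂ)) (𝓝 0)) :
    ∃ Ψ : ℂ → ℂ, DifferentiableOn ℂ Ψ (Metric.ball 0 r) ∧
      ∀ z ∈ {z : ℂ | 0 < z.im} ∩ Metric.ball 0 r, Ψ z = ψ z := by
  rcases le_or_gt r 0 with hr0 | hr
  · exact ⟨ψ, by rw [Metric.ball_eq_empty.2 hr0]; exact differentiableOn_empty, fun _ _ => rfl⟩
  set U : Set ℂ := {z | 0 < z.im} ∩ Metric.ball 0 r with hU
  have hUo : IsOpen U := (isOpen_lt continuous_const continuous_im).inter Metric.isOpen_ball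
  have hUc : Convex ℝ U := (convex_halfSpace_im_gt 0).inter (convex_ball _ _)
  -- Only `im ψ` is controlled at the diameter, so `ψ` need not extend continuously a priori. Its
  -- primitive is Lipschitz, hence does extend; the primitive is reflected instead and then
  -- differentiated.
  obtain ⟨P, hP⟩ := hUc.exists_forall_hasDerivWithinAt hd
  have hPL : LipschitzOnWith M.toNNReal P U :=
    hUc.lipschitzOnWith_of_nnnorm_hasDerivWithin_le hP
      (fun x hx => NNReal.le_toNNReal_of_coe_le (hM x hx))
  obtain ⟨Q, hQL, hQP⟩ := hPL.extend_finite_dimension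
  have hQd : ∀ z ∈ U, HasDerivAt Q (ψ z) z := fun z hz =>
    ((hP z hz).hasDerivAt (hUo.mem_nhds hz)).congr_of_eventuallyEq
      (by filter_upwards [hUo.mem_nhds hz] with y hy using (hQP hy).symm)
  -- On the line at height `y`, the increment of `im Q` is the integral of `im ψ`, which tends to
  -- `0` with `y` by dominated convergence.
  have hconst : ∀ x : ℝ, |x| < r → (Q x).im = (Q 0).im := by
    intro x hx
    have hseg : ∀ t ∈ uIcc 0 x, |t| ≤ |x| := fun t ht => by
      rcases mem_uIcc.1 ht with h | h
      · rw [abs_of_nonneg h.1]; exact h.2.trans (le_abs_self x)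
      · rw [abs_of_nonpos h.2]; linarith [neg_le_abs x, h.1]
    have hlim : ∀ t : ℝ, Tendsto (fun y : ℝ => (t : ℂ) + y * I) (𝓝[>] 0)
        (𝓝[{z | 0 < z.im}] (t : ℂ)) := by
      intro t
      refine tendsto_nhdsWithin_iff.2 ⟨?_, ?_⟩
      · have : Continuous fun y : ℝ => (t : ℂ) + y * I := by fun_prop
        simpa using (this.tendsto 0).mono_left nhdsWithin_le_nhds
      · filter_upwards [self_mem_nhdsWithin] with y hy
        simpa using hy
    have hmem : ∀ᶠ y : ℝ in 𝓝[>] 0, ∀ t ∈ uIcc 0 x, (t : ℂ) + y * I ∈ U := by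
      filter_upwards [Ioo_mem_nhdsGT (sub_pos.2 hx)] with y hy t ht
      refine ⟨by simpa using hy.1, mem_ball_zero_iff.2 ?_⟩
      refine (norm_add_le _ _).trans_lt ?_
      rw [norm_real, norm_mul, norm_I, mul_one, norm_real, Real.norm_eq_abs, Real.norm_eq_abs,
        abs_of_pos hy.1]
      linarith [hseg t ht, hy.2]
    have hQim : ∀ t : ℝ, Tendsto (fun y : ℝ => (Q (t + y * I)).im) (𝓝[>] 0) (𝓝 (Q t).im) :=
      fun t => ((continuous_im.comp hQL.continuous).tendsto (t : ℂ)).comp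
        ((hlim t).mono_right nhdsWithin_le_nhds)
    have hft : ∀ᶠ y : ℝ in 𝓝[>] 0, ∫ t in (0 : ℝ)..x, (ψ (t + y * I)).im =
        (Q (x + y * I)).im - (Q ((0 : ℝ) + y * I)).im := by
      filter_upwards [hmem] with y hy
      refine intervalIntegral.integral_eq_sub_of_hasDerivAt
        (f := fun t : ℝ => (Q (t + y * I)).im) (fun t ht => ?_) ?_
      · have h1 : HasDerivAt (fun t : ℝ => (t : ℂ) + y * I) 1 t :=
          (ofRealCLM.hasDerivAt (x := t)).add_const _
        have h2 := (hQd _ (hy t ht)).scomp_of_eq t h1 rfl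
        simpa [Function.comp_def] using (imCLM.hasFDerivAt.comp_hasDerivAt t h2)
      · refine ContinuousOn.intervalIntegrable ?_
        exact continuous_im.comp_continuousOn (hd.continuousOn.comp (by fun_prop) hy)
    have hint : Tendsto (fun y : ℝ => ∫ t in (0 : ℝ)..x, (ψ (t + y * I)).im) (𝓝[>] 0)
        (𝓝 (∫ t in (0 : ℝ)..x, (0 : ℝ))) := by
      refine intervalIntegral.tendsto_integral_filter_of_dominated_convergence (fun _ => M)
        ?_ ?_ (by simp) ?_
      · filter_upwards [hmem] with y hy
        have hc : ContinuousOn (fun t : ℝ => (ψ (t + y * I)).im) (uIcc 0 x) :=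
          continuous_im.comp_continuousOn (hd.continuousOn.comp (by fun_prop) hy)
        exact (hc.mono uIoc_subset_uIcc).aestronglyMeasurable measurableSet_uIoc
      · filter_upwards [hmem] with y hy
        exact ae_of_all _ fun t ht => (abs_im_le_norm _).trans (hM _ (hy t (uIoc_subset_uIcc ht)))
      · exact ae_of_all _ fun t ht =>
          (him t ((hseg t (uIoc_subset_uIcc ht)).trans_lt hx)).comp (hlim t)
    have h2 := tendsto_nhds_unique (hint.congr' hft) ((hQim x).sub (hQim 0))
    simp only [intervalIntegral.integral_zero, ofReal_zero] at h2
    linarith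
  obtain ⟨W, hW, hWQ⟩ := exists_differentiableOn_ball_of_im_eq_zero
    (Q := fun z => Q z - ((Q 0).im : ℂ) * I) (r := r) (by have := hQL.continuous; fun_prop)
    (fun z hz hi => (hQd z ⟨hi, hz⟩).differentiableAt.sub_const _)
    (fun x hx => by simp [hconst x hx])
  refine ⟨deriv W, hW.deriv Metric.isOpen_ball, fun z hz => ?_⟩
  refine HasDerivAt.deriv (((hQd z hz).sub_const (((Q 0).im : ℂ) * I)).congr_of_eventuallyEq ?_)
  filter_upwards [hUo.mem_nhds hz] with y hy using hWQ y hy.1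

/-! ### The cusp as the image of a half-strip. -/

/-- The map `s ↦ -2π / (a H(s))` onto the cusp in the logarithmic coordinate. -/
noncomputable def cuspMap (a : ℝ) (H : ℂ → ℂ) (s : ℂ) : ℂ := -2 * Real.pi / (a * H s)

namespace IsLogChart

variable {H : ℂ → ℂ} {R B a : ℝ}

theorem cuspMap_ne_zero (h : IsLogChart H R B) (ha : 0 < a) {s : ℂ} (hs : s.re < -R) :
    cuspMap a H s ≠ 0 := by
  have := h.ne_zero hs
  have : (a : ℂ) ≠ 0 := by exact_mod_cast ha.ne'
  have : (Real.pi : ℂ) ≠ 0 := by exact_mod_cast Real.pi_ne_zero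
  simp [cuspMap, *]

theorem eq_of_cuspMap (ha : 0 < a) {s w : ℂ} (hw : cuspMap a H s = w) :
    H s = -2 * Real.pi / (a * w) := by
  have ha' : (a : ℂ) ≠ 0 := by exact_mod_cast ha.ne'
  have hpi : (Real.pi : ℂ) ≠ 0 := by exact_mod_cast Real.pi_ne_zero
  subst hw
  rcases eq_or_ne (H s) 0 with h0 | h0
  · simp [cuspMap, h0]
  · unfold cuspMap
    field_simp

theorem cuspMap_eq (ha : 0 < a) {s w : ℂ} (hw : H s = -2 * Real.pi / (a * w)) :
    cuspMap a H s = w := by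
  have ha' : (a : ℂ) ≠ 0 := by exact_mod_cast ha.ne'
  have hpi : (Real.pi : ℂ) ≠ 0 := by exact_mod_cast Real.pi_ne_zero
  unfold cuspMap
  rw [hw]
  rcases eq_or_ne w 0 with rfl | h0
  · simp
  · field_simp

theorem injOn_cuspMap (h : IsLogChart H R B) (ha : 0 < a) {s t : ℂ} (hs : s.re < -R)
    (ht : t.re < -R) (hst : cuspMap a H s = cuspMap a H t) : s = t :=
  h.injOn hs ht (by rw [eq_of_cuspMap ha hst, ← eq_of_cuspMap ha (rfl : cuspMap a H t = _)])

theorem differentiableAt_cuspMap (h : IsLogChart H R B) (ha : 0 < a) {s : ℂ} (hs : s.re < -R) :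
    DifferentiableAt ℂ (cuspMap a H) s := by
  have ha' : (a : ℂ) ≠ 0 := by exact_mod_cast ha.ne'
  exact (differentiableAt_const _).div ((differentiableAt_const _).mul (h.differentiableAt hs))
    (mul_ne_zero ha' (h.ne_zero hs))

theorem continuousOn_cuspMap (h : IsLogChart H R B) (ha : 0 < a) {C : Set ℂ}
    (hC : ∀ s ∈ C, s.re < -R) : ContinuousOn (cuspMap a H) C := fun s hs =>
  (h.differentiableAt_cuspMap ha (hC s hs)).continuousAt.continuousWithinAt

theorem norm_cuspMap (ha : 0 < a) (s : ℂ) : ‖cuspMap a H s‖ = 2 * Real.pi / (a * ‖H s‖) := by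
  simp [cuspMap, abs_of_pos ha, abs_of_pos Real.pi_pos]

/-- The images of rays that are not horizontal have a nonzero angle at `0`. -/
theorem not_eventually_ray_mem (h : IsLogChart H R B) (ha : 0 < a) {D : Set ℂ}
    (hD : Tendsto arg (𝓝[D] 0) (𝓝 0)) {v : ℂ} (hre : v.re < 0) (him : v.im ≠ 0)
    (hmem : ∀ᶠ t : ℝ in atTop, cuspMap a H (t * v) ∈ D) : False := by
  have hv : v ≠ 0 := fun h0 => by simp [h0] at him
  have ha' : (a : ℂ) ≠ 0 := by exact_mod_cast ha.ne'
  have hH : Tendsto (fun t : ℝ => H (t * v) / t) atTop (𝓝 v) := by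
    rw [tendsto_iff_norm_sub_tendsto_zero]
    have hlim : Tendsto (fun t : ℝ => B / t) atTop (𝓝 0) := tendsto_const_nhds.div_atTop tendsto_id
    refine squeeze_zero' (Eventually.of_forall fun _ => norm_nonneg _) ?_ hlim
    filter_upwards [eventually_gt_atTop 0, eventually_gt_atTop (R / -v.re)] with t ht ht'
    have hre' : ((t : ℂ) * v).re < -R := by
      rw [div_lt_iff₀ (by linarith)] at ht'
      simp only [re_ofReal_mul]
      linarith
    have ht0 : (t : ℂ) ≠ 0 := by exact_mod_cast ht.ne'
    rw [show H (t * v) / t - v = (H (t * v) - t * v) / t by field_simp, norm_div, norm_real,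
      Real.norm_eq_abs, abs_of_pos ht]
    gcongr
    exact h.norm_sub_le _ hre'
  -- Positive scaling does not change `arg`, so along the ray `arg` tends to that of the non-real
  -- number `-2π / (a v)`, which is not `0`.
  have hlim : Tendsto (fun t : ℝ => (t : ℂ) * cuspMap a H (t * v)) atTop
      (𝓝 (-2 * Real.pi / (a * v))) := by
    refine (tendsto_const_nhds.div (tendsto_const_nhds.mul hH) (mul_ne_zero ha' hv)).congr' ?_
    filter_upwards [eventually_gt_atTop 0] with t ht
    have ht0 : (t : ℂ) ≠ 0 := by exact_mod_cast ht.ne'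
    simp only [Pi.div_apply, cuspMap]
    rw [mul_div_assoc', div_div_eq_mul_div]
    ring
  have him' : (-2 * Real.pi / (a * v) : ℂ).im ≠ 0 := by
    have : (-2 * Real.pi / (a * v) : ℂ) = ((-2 * Real.pi / a : ℝ) : ℂ) * v⁻¹ := by
      push_cast
      field_simp
    rw [this, im_ofReal_mul, inv_im]
    exact mul_ne_zero (div_ne_zero (by simp [Real.pi_ne_zero]) ha.ne')
      (div_ne_zero (neg_ne_zero.2 him) (normSq_pos.2 hv).ne')
  have hzero : Tendsto (fun t : ℝ => cuspMap a H (t * v)) atTop (𝓝 0) := by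
    have hinv : Tendsto (fun t : ℝ => (t : ℂ)⁻¹) atTop (𝓝 0) := by
      have := (continuous_ofReal.tendsto 0).comp tendsto_inv_atTop_zero
      simpa [Function.comp_def] using this
    have := hinv.mul hlim
    rw [zero_mul] at this
    refine this.congr' ?_
    filter_upwards [eventually_gt_atTop 0] with t ht
    have ht0 : (t : ℂ) ≠ 0 := by exact_mod_cast ht.ne'
    field_simp
  have h1 := hD.comp (tendsto_nhdsWithin_iff.2 ⟨hzero, hmem⟩)
  have h2 := (continuousAt_arg (Or.inr him')).tendsto.comp hlim
  have h3 := tendsto_nhds_unique (h1.congr' ?_) h2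
  · exact him' (arg_eq_zero_iff.1 h3.symm).2
  · filter_upwards [eventually_gt_atTop 0] with t ht
    exact (arg_real_mul _ ht).symm

/-- The image of `C` is connected and misses the frontier, so it lies wholly in `D` or wholly in the
exterior. -/
theorem image_subset_of_disjoint_frontier (h : IsLogChart H R B) (ha : 0 < a) {D C : Set ℂ}
    (hD : IsOpen D) (hC : ∀ s ∈ C, s.re < -R) (hconv : Convex ℝ C)
    (hfr : ∀ s ∈ C, cuspMap a H s ∉ frontier D) {s₀ : ℂ} (hs₀ : s₀ ∈ C)
    (hs₀D : cuspMap a H s₀ ∈ D) : ∀ s ∈ C, cuspMap a H s ∈ D := by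
  have hpre : IsPreconnected (cuspMap a H '' C) :=
    hconv.isPreconnected.image _ (h.continuousOn_cuspMap ha hC)
  have hsub : cuspMap a H '' C ⊆ D ∪ (closure D)ᶜ := by
    rintro _ ⟨s, hs, rfl⟩
    by_cases hcl : cuspMap a H s ∈ closure D
    · left
      by_contra hn
      exact hfr s hs ⟨hcl, by rwa [hD.interior_eq]⟩
    · exact Or.inr hcl
  have := hpre.subset_left_of_subset_union hD isClosed_closure.isOpen_compl
    (disjoint_compl_right.mono_left subset_closure) hsub ⟨_, ⟨s₀, hs₀, rfl⟩, hs₀D⟩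
  exact fun s hs => this ⟨s, hs, rfl⟩

end IsLogChart

/-- The part of the boundary of `D` near the cusp corresponds to the lines `im s = 0`, `π`. -/
theorem HasCuspAtZero.exists_notMem_frontier {D : Set ℂ} {a ε R B : ℝ} {c : ℕ → ℕ → ℝ} {H : ℂ → ℂ}
    (hcusp : HasCuspAtZero D a c ε) (hε : 0 < ε) (ha : 0 < a) (h : IsLogChart H R B)
    (hf : ∀ x : ℂ, cuspSeries a c x = cuspMap a H (Complex.log x)) :
    ∃ R₀, R ≤ R₀ ∧ ∀ s : ℂ, s.re < -R₀ → s.im ≠ 0 → s.im ≠ Real.pi →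
      cuspMap a H s ∉ frontier D := by
  -- Shortening the arc below `exp (-R)` puts the logarithms of its nonzero parameters into `re s <
  -- -R`, where `cuspMap` is injective.
  set δ := min ε (Real.exp (-R) / 2) with hδ
  have hδ0 : 0 < δ := lt_min hε (by positivity)
  obtain ⟨r, hr, hfr⟩ := hcusp.frontier_eq δ hδ0 (min_le_left _ _)
  refine ⟨max R (B + 2 * Real.pi / (a * r)), le_max_left _ _, fun s hs h0 hpi hmem => ?_⟩
  have hsR : s.re < -R := by linarith [le_max_left R (B + 2 * Real.pi / (a * r))]
  have hball : cuspMap a H s ∈ Metric.ball (0 : ℂ) r := by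
    rw [mem_ball_zero_iff, IsLogChart.norm_cuspMap ha]
    have h1 := (h.mono (le_max_left R (B + 2 * Real.pi / (a * r)))).lt_norm hs
    have h2 : 2 * Real.pi / (a * r) < ‖H s‖ := by
      linarith [le_max_right R (B + 2 * Real.pi / (a * r))]
    have h3 : 0 < ‖H s‖ := norm_pos_iff.2 (h.ne_zero hsR)
    rw [div_lt_iff₀ (by positivity)] at h2 ⊢
    linarith
  have := hfr.subset ⟨hmem, hball⟩
  rcases this.1 with ⟨x, -, hx⟩ | ⟨x, hx, hxs⟩
  -- A real value forces `H s` to be real, hence `s` and its conjugate have the same image under the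
  -- injective `H`.
  · have hH := IsLogChart.eq_of_cuspMap ha hx.symm
    have hc : starRingEnd ℂ (H s) = H s := by
      rw [hH, show (-2 * Real.pi / (a * (x : ℂ)) : ℂ) = ((-2 * Real.pi / (a * x) : ℝ) : ℂ) by
        push_cast; rfl, conj_ofReal]
    rw [← h.conj s hsR] at hc
    exact h0 (conj_eq_iff_im.1 (h.injOn (by simpa using hsR) hsR hc))
  · simp only at hxs
    rcases hx.2.lt_or_eq with hneg | rfl
    · rw [hf] at hxs
      have hre : (Complex.log x).re < -R := by
        rw [log_re, norm_real, Real.norm_eq_abs, abs_of_neg hneg,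
          Real.log_lt_iff_lt_exp (by linarith)]
        have := hx.1
        have := min_le_right ε (Real.exp (-R) / 2)
        linarith [Real.exp_pos (-R)]
      rw [← h.injOn_cuspMap ha hre hsR hxs, log_im, arg_ofReal_of_neg hneg] at hpi
      exact hpi rfl
    · exact h.cuspMap_ne_zero ha hsR (by rw [← hxs]; simp [cuspSeries])

/-- Near the cusp `D` is the image of a half-strip of height `π`. -/
theorem HasCuspAtZero.exists_halfStrip {D : Set ℂ} {a ε R B : ℝ} {c : ℕ → ℕ → ℝ} {H : ℂ → ℂ}
    (hcusp : HasCuspAtZero D a c ε) (hD : IsOpen D) (h0D : (𝓝[D] (0 : ℂ)).NeBot)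
    (hε : 0 < ε) (ha : 0 < a) (h : IsLogChart H R B)
    (hf : ∀ x : ℂ, cuspSeries a c x = cuspMap a H (Complex.log x)) :
    ∃ R₀, R ≤ R₀ ∧ ∀ R', R₀ ≤ R' →
      (∀ s : ℂ, s.re < -R' → 0 < s.im → s.im < Real.pi → cuspMap a H s ∈ D) ∧
      ∀ᶠ w in 𝓝[D] 0, ∃ s : ℂ, s.re < -R' ∧ 0 < s.im ∧ s.im < Real.pi ∧ cuspMap a H s = w := by
  obtain ⟨R₀, hR₀, hfr⟩ := hcusp.exists_notMem_frontier hε ha h hf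
  refine ⟨R₀, hR₀, fun R' hR' => ?_⟩
  have h' := h.mono (hR₀.trans hR')
  have hfr' : ∀ s : ℂ, s.re < -R' → s.im ≠ 0 → s.im ≠ Real.pi → cuspMap a H s ∉ frontier D :=
    fun s hs => hfr s (by linarith)
  have hpi := Real.pi_pos
  have hray : ∀ v : ℂ, v.re = -1 → ∀ᶠ t : ℝ in atTop, ((t : ℂ) * v).re < -R' := by
    intro v hv
    filter_upwards [eventually_gt_atTop R'] with t ht
    rw [re_ofReal_mul, hv]
    linarith
  -- One such point would put the image of the whole quadrant into `D`, including a slanted ray,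
  -- contrary to the zero angle.
  have hlow : ∀ s : ℂ, s.re < -R' → s.im < 0 → cuspMap a H s ∉ D := by
    intro s hs him hsD
    have hall := h'.image_subset_of_disjoint_frontier ha hD
      (C := {s | s.re < -R'} ∩ {s | s.im < 0}) (fun s hs => hs.1)
      ((convex_halfSpace_re_lt _).inter (convex_halfSpace_im_lt _))
      (fun s hs => hfr' s hs.1 (ne_of_lt hs.2) (ne_of_lt (lt_trans hs.2 hpi))) ⟨hs, him⟩ hsD
    refine h'.not_eventually_ray_mem ha hcusp.angle_eq_zero (v := -1 - I) (by simp) (by simp) ?_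
    filter_upwards [hray (-1 - I) (by simp), eventually_gt_atTop 0] with t ht ht0
    refine hall _ ⟨ht, ?_⟩
    simpa using ht0
  have hhigh : ∀ s : ℂ, s.re < -R' → Real.pi < s.im → cuspMap a H s ∉ D := by
    intro s hs him hsD
    have hall := h'.image_subset_of_disjoint_frontier ha hD
      (C := {s | s.re < -R'} ∩ {s | Real.pi < s.im}) (fun s hs => hs.1)
      ((convex_halfSpace_re_lt _).inter (convex_halfSpace_im_gt _))
      (fun s hs => hfr' s hs.1 (ne_of_gt (lt_trans hpi hs.2)) (ne_of_gt hs.2)) ⟨hs, him⟩ hsD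
    refine h'.not_eventually_ray_mem ha hcusp.angle_eq_zero (v := -1 + I) (by simp) (by simp) ?_
    filter_upwards [hray (-1 + I) (by simp), eventually_gt_atTop Real.pi] with t ht ht0
    refine hall _ ⟨ht, ?_⟩
    simpa using ht0
  -- Since `D` is open, a point of `D` on an edge of the strip would have neighbours in `D` beyond
  -- the edge.
  have hline : ∀ s : ℂ, s.re < -R' → cuspMap a H s ∈ D → ∀ σ : ℝ,
      ∃ τ > 0, cuspMap a H (s + (σ * τ : ℝ) * I) ∈ D := by
    intro s hs hsD σ
    have hcont : ContinuousAt (fun τ : ℝ => cuspMap a H (s + (σ * τ : ℝ) * I)) 0 := by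
      refine ContinuousAt.comp_of_eq (f := fun τ : ℝ => s + (σ * τ : ℝ) * I) (x := 0)
        (h'.differentiableAt_cuspMap ha hs).continuousAt ?_ (by simp)
      exact Continuous.continuousAt (by fun_prop)
    have hev := hcont.eventually (hD.mem_nhds (by simpa using hsD))
    have := hev.filter_mono (nhdsWithin_le_nhds (s := Ioi 0))
    obtain ⟨τ, hτ, hτ0⟩ := (this.and self_mem_nhdsWithin).exists
    exact ⟨τ, hτ0, hτ⟩
  have h0 : (0 : ℂ) ∉ D := by
    obtain ⟨r, hr, hfr⟩ := hcusp.frontier_eq ε hε le_rfl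
    have : (0 : ℂ) ∈ frontier D := (hfr.superset
      ⟨Or.inl ⟨0, ⟨le_rfl, hε.le⟩, by simp⟩, Metric.mem_ball_self hr⟩).1
    rw [hD.frontier_eq] at this
    exact this.2
  have hsurj : ∀ᶠ w in 𝓝[D] 0,
      ∃ s : ℂ, s.re < -R' ∧ 0 < s.im ∧ s.im < Real.pi ∧ cuspMap a H s = w := by
    have hsmall : ∀ᶠ w : ℂ in 𝓝[D] 0, ‖w‖ < Real.pi / (a * (R' + 1 + B)) := by
      have : 0 < Real.pi / (a * (R' + 1 + B)) := by
        have := h'.pos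
        have := h'.lt
        have : 0 < R' + 1 + B := by linarith
        positivity
      filter_upwards [mem_nhdsWithin_of_mem_nhds (Metric.ball_mem_nhds (0 : ℂ) this)] with w hw
      simpa using hw
    have hang : ∀ᶠ w : ℂ in 𝓝[D] 0, |arg w| < Real.pi / 3 := by
      filter_upwards [hcusp.angle_eq_zero.eventually
        (Metric.ball_mem_nhds (0 : ℝ) (show 0 < Real.pi / 3 by positivity))] with w hw
      simpa using hw
    filter_upwards [hsmall, hang, self_mem_nhdsWithin] with w hw hwa hwD
    have hw0 : w ≠ 0 := fun h => h0 (h ▸ hwD)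
    have hwn : 0 < ‖w‖ := norm_pos_iff.2 hw0
    -- With `|arg w| < π / 3`, `re (1 / w) ≥ 1 / (2 |w|)`, so small `w` put `-2π / (a w)` far enough
    -- left to be a value of `H`.
    have hcos : 1 / 2 ≤ Real.cos (arg w) := by
      rw [← Real.cos_abs, ← Real.cos_pi_div_three]
      exact Real.cos_le_cos_of_nonneg_of_le_pi (abs_nonneg _) (by linarith) hwa.le
    have hre : (-2 * Real.pi / (a * w) : ℂ).re ≤ -(R' + 1 + B) := by
      have e : (-2 * Real.pi / (a * w) : ℂ) = ((-2 * Real.pi / a : ℝ) : ℂ) * w⁻¹ := by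
        have : (a : ℂ) ≠ 0 := by exact_mod_cast ha.ne'
        push_cast
        field_simp
      rw [e, re_ofReal_mul, inv_re, normSq_eq_norm_sq]
      have hre := norm_mul_cos_arg w
      have h3 : 1 / (2 * ‖w‖) ≤ w.re / ‖w‖ ^ 2 := by
        rw [← hre, div_le_div_iff₀ (by positivity) (by positivity)]
        nlinarith [sq_nonneg ‖w‖]
      have h4 : 2 * Real.pi / a * (1 / (2 * ‖w‖)) ≤ 2 * Real.pi / a * (w.re / ‖w‖ ^ 2) := by
        gcongr
      have h5 : R' + 1 + B ≤ 2 * Real.pi / a * (1 / (2 * ‖w‖)) := by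
        have h7 : 0 < R' + 1 + B := by linarith [h'.pos, h'.lt]
        rw [lt_div_iff₀ (by positivity)] at hw
        rw [show 2 * Real.pi / a * (1 / (2 * ‖w‖)) = Real.pi / (a * ‖w‖) by field_simp,
          le_div_iff₀ (by positivity)]
        linarith
      have h6 : -2 * Real.pi / a * (w.re / ‖w‖ ^ 2) = -(2 * Real.pi / a * (w.re / ‖w‖ ^ 2)) := by
        ring
      linarith
    obtain ⟨s, hs, hsH⟩ := h'.exists_eq hre
    have hsw := IsLogChart.cuspMap_eq ha hsH
    have hsD : cuspMap a H s ∈ D := hsw ▸ hwD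
    refine ⟨s, hs, ?_, ?_, hsw⟩
    · by_contra! hle
      rcases hle.lt_or_eq with hlt | heq
      · exact hlow s hs hlt hsD
      · obtain ⟨τ, hτ, hτD⟩ := hline s hs hsD (-1)
        exact hlow _ (by simpa using hs) (by simpa [heq] using hτ) hτD
    · by_contra! hle
      rcases hle.lt_or_eq with hlt | heq
      · exact hhigh s hs hlt hsD
      · obtain ⟨τ, hτ, hτD⟩ := hline s hs hsD 1
        exact hhigh _ (by simpa using hs) (by simpa [← heq] using hτ) hτD
  refine ⟨fun s hs hs0 hspi => ?_, hsurj⟩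
  -- `D` accumulates at `0`, so some point of the half-strip maps into `D`, and connectedness
  -- carries the rest along.
  obtain ⟨w, ⟨s₀, hs₀, hs₀0, hs₀pi, hs₀w⟩, hwD⟩ := (hsurj.and self_mem_nhdsWithin).exists
  exact h'.image_subset_of_disjoint_frontier ha hD
    (C := {s | s.re < -R'} ∩ ({s | 0 < s.im} ∩ {s | s.im < Real.pi})) (fun s hs => hs.1)
    ((convex_halfSpace_re_lt _).inter ((convex_halfSpace_im_gt _).inter (convex_halfSpace_im_lt _)))
    (fun s hs => hfr' s hs.1 (ne_of_gt hs.2.1) (ne_of_lt hs.2.2)) (s₀ := s₀)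
    ⟨hs₀, hs₀0, hs₀pi⟩ (hs₀w ▸ hwD) s ⟨hs, hs0, hspi⟩

/-! ### Lifting the conformal map to the half-strip. -/

/-- The lower bound `‖s - t‖ ≤ 2 * ‖H s - H t‖` makes the inverse continuous, and `deriv_ne_zero`
then makes it holomorphic. -/
theorem IsLogChart.exists_inverse {H : ℂ → ℂ} {R B : ℝ} (h : IsLogChart H R B) :
    ∃ T : ℂ → ℂ, DifferentiableOn ℂ T {ζ | ζ.re < -(R + 1 + B)} ∧
      ∀ s : ℂ, s.re < -R → (H s).re < -(R + 1 + B) → T (H s) = s := by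
  have hex : ∀ ζ : ℂ, ∃ s : ℂ, ζ.re ≤ -(R + 1 + B) → s.re < -R ∧ H s = ζ := by
    intro ζ
    by_cases hζ : ζ.re ≤ -(R + 1 + B)
    · obtain ⟨s, hs⟩ := h.exists_eq hζ
      exact ⟨s, fun _ => hs⟩
    · exact ⟨0, fun h => absurd h hζ⟩
  choose T hT using hex
  have ho : IsOpen {ζ : ℂ | ζ.re < -(R + 1 + B)} := isOpen_lt continuous_re continuous_const
  refine ⟨T, fun ζ hζ => ?_, fun s hs hHs => ?_⟩
  · have hlip : ∀ᶠ η in 𝓝 ζ, ‖T η - T ζ‖ ≤ 2 * ‖η - ζ‖ := by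
      filter_upwards [ho.mem_nhds hζ] with η hη
      have h1 := hT η (le_of_lt hη)
      have h2 := hT ζ (le_of_lt hζ)
      have := h.norm_sub_le_two_mul h1.1 h2.1
      rwa [h1.2, h2.2] at this
    have hcont : ContinuousAt T ζ := by
      rw [ContinuousAt, tendsto_iff_norm_sub_tendsto_zero]
      refine squeeze_zero' (Eventually.of_forall fun _ => norm_nonneg _) hlip ?_
      have : Continuous fun η : ℂ => 2 * ‖η - ζ‖ := by fun_prop
      simpa using this.tendsto ζ
    have hre := (hT ζ (le_of_lt hζ)).1
    refine (HasDerivAt.of_local_left_inverse hcont (h.differentiableAt hre).hasDerivAt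
      (h.deriv_ne_zero hre) ?_).differentiableAt.differentiableWithinAt
    filter_upwards [ho.mem_nhds hζ] with η hη using (hT η (le_of_lt hη)).2
  · have := hT (H s) hHs.le
    exact h.injOn this.1 hs this.2

/-- A function holomorphic at `0` that maps the upper half-plane into itself vanishes there at
most to first order. -/
theorem exists_eq_mul_of_im_pos {Ψ : ℂ → ℂ} (hΨ : AnalyticAt ℂ Ψ 0) (h0 : Ψ 0 = 0)
    (him : ∀ᶠ z in 𝓝[{z : ℂ | 0 < z.im}] 0, 0 < (Ψ z).im) :
    ∃ k : ℂ → ℂ, ContinuousAt k 0 ∧ k 0 ≠ 0 ∧ ∀ᶠ z in 𝓝 0, Ψ z = z * k z := by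
  have hdir : ∀ u : ℂ, 0 < u.im → Tendsto (fun t : ℝ => (t : ℂ) * u) (𝓝[>] 0)
      (𝓝[{z : ℂ | 0 < z.im}] 0) := by
    intro u hu
    refine tendsto_nhdsWithin_iff.2 ⟨?_, ?_⟩
    · have : Continuous fun t : ℝ => (t : ℂ) * u := by fun_prop
      simpa using (this.tendsto 0).mono_left nhdsWithin_le_nhds
    · filter_upwards [self_mem_nhdsWithin] with t ht
      simpa [im_ofReal_mul] using mul_pos (show (0 : ℝ) < t from ht) hu
  have hnz : ¬ ∀ᶠ z in 𝓝 (0 : ℂ), Ψ z = 0 := by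
    intro hz
    have h1 := (hdir I (by simp)).eventually him
    have h2 := (hdir I (by simp)).eventually (hz.filter_mono nhdsWithin_le_nhds)
    obtain ⟨t, ht, ht'⟩ := (h1.and h2).exists
    simp [ht'] at ht
  obtain ⟨n, k, hk, hk0, hΨk⟩ := hΨ.exists_eventuallyEq_pow_smul_nonzero_iff.2 hnz
  simp only [sub_zero, smul_eq_mul] at hΨk
  have hn0 : n ≠ 0 := by
    rintro rfl
    have := hΨk.self_of_nhds
    simp [h0] at this
    exact hk0 this.symm
  have hn1 : n < 2 := by
    by_contra! hn
    have hpi := Real.pi_pos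
    have hn' : (2 : ℝ) ≤ n := by exact_mod_cast hn
    -- For `n ≥ 2` every `φ` in `(0, 2π)` is `n` times an angle in `(0, π)`, so `exp (φ I) * k 0`
    -- would stay in the closed upper half-plane; four angles contradict this.
    have hpos : ∀ φ : ℝ, 0 < φ → φ < 2 * Real.pi → 0 ≤ (exp (φ * I) * k 0).im := by
      intro φ hφ hφ'
      set u : ℂ := exp ((φ / n : ℝ) * I) with hu
      have hun : u ^ n = exp (φ * I) := by
        rw [hu, ← exp_nat_mul]
        congr 1
        push_cast
        field_simp
      have huim : 0 < u.im := by
        rw [hu, exp_ofReal_mul_I_im]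
        refine Real.sin_pos_of_pos_of_lt_pi (by positivity) ?_
        rw [div_lt_iff₀ (by positivity)]
        nlinarith
      have ht := hdir u huim
      have hlim : Tendsto (fun t : ℝ => (exp (φ * I) * k (t * u)).im) (𝓝[>] 0)
          (𝓝 (exp (φ * I) * k 0).im) :=
        (continuous_im.tendsto _).comp (tendsto_const_nhds.mul
          (hk.continuousAt.tendsto.comp (ht.mono_right nhdsWithin_le_nhds)))
      refine ge_of_tendsto hlim ?_
      filter_upwards [ht.eventually him, ht.eventually (hΨk.filter_mono nhdsWithin_le_nhds),
        self_mem_nhdsWithin] with t h1 h2 ht0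
      rw [h2, mul_pow, hun, mul_assoc, ← ofReal_pow, im_ofReal_mul] at h1
      exact (pos_of_mul_pos_right h1 (pow_nonneg (le_of_lt ht0) _)).le
    have hval : ∀ φ : ℝ, (exp (φ * I) * k 0).im =
        Real.cos φ * (k 0).im + Real.sin φ * (k 0).re := by
      intro φ
      rw [mul_im, exp_ofReal_mul_I_re, exp_ofReal_mul_I_im]
    have e1 := hpos (Real.pi / 2) (by linarith) (by linarith)
    have e2 := hpos Real.pi (by linarith) (by linarith)
    have e3 := hpos (Real.pi / 2 + Real.pi) (by linarith) (by linarith)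
    have e4 := hpos (Real.pi / 4) (by linarith) (by linarith)
    rw [hval] at e1 e2 e3 e4
    simp only [Real.cos_add_pi, Real.sin_add_pi, Real.cos_pi_div_two, Real.sin_pi_div_two,
      Real.cos_pi, Real.sin_pi, Real.cos_pi_div_four, Real.sin_pi_div_four] at e1 e2 e3 e4
    have hs : 0 < √2 / 2 := by positivity
    have hre : (k 0).re = 0 := by linarith
    have him0 : (k 0).im = 0 := by
      rw [hre, mul_zero, add_zero] at e4
      linarith [nonneg_of_mul_nonneg_right e4 hs]
    exact hk0 (Complex.ext hre him0)
  obtain rfl : n = 1 := by omega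
  exact ⟨k, hk.continuousAt, hk0, by simpa using hΨk⟩

/-- By the open mapping theorem the images of `im z > 1 / (n + 1)` form an increasing open cover of
`K`. Thus `g z` leaves every compact subset of `D` as `z` nears the real axis. -/
theorem IsConformalMapOnto.exists_subset_image_im_gt {g : ℂ → ℂ} {D K : Set ℂ}
    (hg : IsConformalMapOnto g {z : ℂ | 0 < z.im} D) (hK : IsCompact K) (hKD : K ⊆ D) :
    ∃ m > 0, K ⊆ g '' {z : ℂ | m < z.im} := by
  have ho : IsOpen {z : ℂ | 0 < z.im} := isOpen_lt continuous_const continuous_im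
  have hopen : ∀ m : ℝ, 0 < m → IsOpen (g '' {z : ℂ | m < z.im}) := by
    intro m hm
    rcases (hg.differentiableOn.analyticOnNhd ho).is_constant_or_isOpen
      (convex_halfSpace_im_gt 0).isPreconnected with ⟨w, hw⟩ | h
    · have h1 : (I : ℂ) = 2 * I := hg.bijOn.injOn (by simp) (by simp)
        ((hw _ (by simp)).trans (hw _ (by simp)).symm)
      have := congrArg Complex.im h1
      norm_num at this
    · exact h _ (fun z hz => hm.trans hz) (isOpen_lt continuous_const continuous_im)
  obtain ⟨n, hn⟩ := hK.elim_directed_cover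
    (fun n : ℕ => g '' {z : ℂ | 1 / ((n : ℝ) + 1) < z.im}) (fun n => hopen _ (by positivity))
    (fun w hw => by
      obtain ⟨z, hz, rfl⟩ := hg.bijOn.surjOn (hKD hw)
      obtain ⟨n, hn⟩ := exists_nat_one_div_lt (show 0 < z.im from hz)
      exact mem_iUnion.2 ⟨n, z, hn, rfl⟩)
    (Monotone.directed_le fun m n hmn => image_mono fun z hz => by
      refine lt_of_le_of_lt ?_ (show 1 / ((m : ℝ) + 1) < z.im from hz)
      gcongr)
  exact ⟨_, by positivity, hn⟩

/-- The logarithm of the straightened conformal map: near `0` the map `g` factors through the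
half-strip, and `im (exp S)` tends to zero at the real axis. -/
theorem IsConformalMapOnto.exists_log_factor {D : Set ℂ} {a ε R B : ℝ} {c : ℕ → ℕ → ℝ}
    {H g : ℂ → ℂ} (hg : IsConformalMapOnto g {z : ℂ | 0 < z.im} D)
    (hg0 : Tendsto g (𝓝[{z : ℂ | 0 < z.im}] 0) (𝓝 0))
    (hcusp : HasCuspAtZero D a c ε) (hD : IsOpen D) (hε : 0 < ε) (ha : 0 < a)
    (h : IsLogChart H R B) (hf : ∀ x : ℂ, cuspSeries a c x = cuspMap a H (Complex.log x)) :
    ∃ (S : ℂ → ℂ) (r : ℝ), 0 < r ∧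
      DifferentiableOn ℂ S ({z | 0 < z.im} ∩ Metric.ball 0 r) ∧
      (∀ z ∈ {z : ℂ | 0 < z.im} ∩ Metric.ball 0 r,
        (S z).re < -R ∧ 0 < (S z).im ∧ (S z).im < Real.pi ∧ cuspMap a H (S z) = g z) ∧
      Tendsto (fun z => (S z).re) (𝓝[{z : ℂ | 0 < z.im}] 0) atBot ∧
      ∀ x : ℝ, |x| < r →
        Tendsto (fun z => (exp (S z)).im) (𝓝[{z | 0 < z.im}] (x : ℂ)) (𝓝 0) := by
  have hgD : Tendsto g (𝓝[{z : ℂ | 0 < z.im}] 0) (𝓝[D] 0) :=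
    tendsto_nhdsWithin_iff.2 ⟨hg0, by
      filter_upwards [self_mem_nhdsWithin] with z hz using hg.bijOn.mapsTo hz⟩
  have hNe : (𝓝[{z : ℂ | 0 < z.im}] (0 : ℂ)).NeBot := by
    rw [← mem_closure_iff_nhdsWithin_neBot, closure_setOfPred_lt_im]
    simp
  obtain ⟨R₀, hR₀, hstrip⟩ := hcusp.exists_halfStrip hD (hgD.neBot) hε ha h hf
  have h' := h.mono hR₀
  obtain ⟨T, hTd, hT⟩ := h'.exists_inverse
  -- `H` moves points by at most `B`, so this margin puts `H s` inside the domain of the inverse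
  -- `T`.
  have hev := hgD.eventually (hstrip (R₀ + 2 + 2 * B) (by linarith [h.pos])).2
  rw [eventually_nhdsWithin_iff, Metric.eventually_nhds_iff_ball] at hev
  obtain ⟨r, hr, hrs⟩ := hev
  set S : ℂ → ℂ := fun z => T (-2 * Real.pi / (a * g z)) with hS
  have hSz : ∀ z s : ℂ, s.re < -(R₀ + 2 + 2 * B) → cuspMap a H s = g z →
      S z = s ∧ (-2 * Real.pi / (a * g z) : ℂ).re < -(R₀ + 1 + B) := by
    intro z s hs hsg
    have hH := IsLogChart.eq_of_cuspMap ha hsg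
    have hsR : s.re < -R₀ := by linarith [h.pos]
    have hre := (abs_le.1 ((abs_re_le_norm _).trans (h'.norm_sub_le s hsR))).2
    rw [sub_re] at hre
    have hlt : (H s).re < -(R₀ + 1 + B) := by linarith
    exact ⟨by rw [hS]; simp only; rw [← hH]; exact hT s hsR hlt, hH ▸ hlt⟩
  have hSU : ∀ z ∈ {z : ℂ | 0 < z.im} ∩ Metric.ball 0 r, (S z).re < -(R₀ + 2 + 2 * B) ∧
      0 < (S z).im ∧ (S z).im < Real.pi ∧ cuspMap a H (S z) = g z ∧
      (-2 * Real.pi / (a * g z) : ℂ).re < -(R₀ + 1 + B) := by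
    rintro z ⟨hz, hzr⟩
    obtain ⟨s, hs, hs0, hspi, hsg⟩ := hrs z hzr hz
    obtain ⟨h1, h2⟩ := hSz z s hs hsg
    rw [h1]
    exact ⟨hs, hs0, hspi, hsg, h2⟩
  have ho : IsOpen {z : ℂ | 0 < z.im} := isOpen_lt continuous_const continuous_im
  have hoT : IsOpen {ζ : ℂ | ζ.re < -(R₀ + 1 + B)} := isOpen_lt continuous_re continuous_const
  refine ⟨S, r, hr, ?_, ?_, ?_, ?_⟩
  · intro z hz
    obtain ⟨hs, -, -, hsg, hre⟩ := hSU z hz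
    have hgz : g z ≠ 0 := by
      rw [← hsg]
      exact h'.cuspMap_ne_zero ha (by linarith [h.pos])
    have ha' : (a : ℂ) ≠ 0 := by exact_mod_cast ha.ne'
    have hgd := hg.differentiableOn.differentiableAt (ho.mem_nhds hz.1)
    have hq : DifferentiableAt ℂ (fun z => -2 * Real.pi / (a * g z) : ℂ → ℂ) z :=
      (differentiableAt_const _).div ((differentiableAt_const _).mul hgd) (mul_ne_zero ha' hgz)
    exact (DifferentiableAt.comp z (hTd.differentiableAt (hoT.mem_nhds hre))
      hq).differentiableWithinAt
  · intro z hz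
    obtain ⟨hs, hs0, hspi, hsg, -⟩ := hSU z hz
    exact ⟨by linarith [h.pos], hs0, hspi, hsg⟩
  · rw [tendsto_atBot]
    intro X
    have hX := hgD.eventually
      (hstrip (max (R₀ + 2 + 2 * B) (-X)) (le_max_of_le_left (by linarith [h.pos]))).2
    filter_upwards [hX] with z hz
    obtain ⟨s, hs, -, -, hsg⟩ := hz
    have := le_max_left (R₀ + 2 + 2 * B) (-X)
    have := le_max_right (R₀ + 2 + 2 * B) (-X)
    rw [(hSz z s (by linarith) hsg).1]
    linarith
  · intro x hx
    have hpos : ∀ z ∈ {z : ℂ | 0 < z.im} ∩ Metric.ball 0 r, 0 < (exp (S z)).im := by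
      intro z hz
      obtain ⟨-, hs0, hspi, -⟩ := hSU z hz
      rw [exp_im]
      exact mul_pos (Real.exp_pos _) (Real.sin_pos_of_pos_of_lt_pi hs0 hspi)
    have hmem : ∀ᶠ z in 𝓝[{z : ℂ | 0 < z.im}] (x : ℂ),
        z ∈ {z : ℂ | 0 < z.im} ∩ Metric.ball 0 r :=
      inter_mem self_mem_nhdsWithin (mem_nhdsWithin_of_mem_nhds
        (Metric.isOpen_ball.mem_nhds (by simpa using hx)))
    rw [Metric.tendsto_nhds]
    intro κ hκ
    -- The bound `κ ≤ im (exp s)` bounds `re s` below and keeps `s` off the edges of the strip. So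
    -- `K` is compact with image in `D`, and `S z` avoids it once `z` is near the real axis.
    set K : Set ℂ := {s | s.re ≤ -(R₀ + 2 + 2 * B) ∧ 0 ≤ s.im ∧ s.im ≤ Real.pi ∧
      κ ≤ (exp s).im} with hK
    have hKc : IsCompact K := by
      refine Metric.isCompact_of_isClosed_isBounded ?_ ?_
      · refine IsClosed.and (isClosed_le continuous_re continuous_const) (IsClosed.and
          (isClosed_le continuous_const continuous_im) (IsClosed.and
          (isClosed_le continuous_im continuous_const) (isClosed_le continuous_const ?_)))
        fun_prop
      · refine ((Metric.isBounded_Icc (Real.log κ) (-(R₀ + 2 + 2 * B))).reProdIm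
          (Metric.isBounded_Icc 0 Real.pi)).subset ?_
        rintro s ⟨h1, h2, h3, h4⟩
        refine ⟨⟨?_, h1⟩, h2, h3⟩
        rw [Real.log_le_iff_le_exp hκ]
        refine h4.trans ?_
        rw [← norm_exp]
        exact (le_abs_self _).trans (abs_im_le_norm _)
    have hKD : cuspMap a H '' K ⊆ D := by
      rintro _ ⟨s, ⟨h1, h2, h3, h4⟩, rfl⟩
      rw [exp_im] at h4
      refine (hstrip R₀ le_rfl).1 s (by linarith [h.pos]) (h2.lt_of_ne ?_) (h3.lt_of_ne ?_)
      · intro he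
        rw [← he, Real.sin_zero] at h4
        linarith
      · intro he
        rw [he, Real.sin_pi] at h4
        linarith
    obtain ⟨m, hm, hKm⟩ := hg.exists_subset_image_im_gt
      (hKc.image_of_continuousOn (h'.continuousOn_cuspMap ha fun s hs => by
        linarith [hs.1, h.pos])) hKD
    have hlow : ∀ᶠ z in 𝓝[{z : ℂ | 0 < z.im}] (x : ℂ), z.im < m :=
      mem_nhdsWithin_of_mem_nhds
        ((isOpen_lt continuous_im continuous_const).mem_nhds (by simpa using hm))
    filter_upwards [hmem, hlow] with z hz hzm
    rw [Real.dist_eq, sub_zero, abs_of_pos (hpos z hz)]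
    by_contra! hge
    obtain ⟨hs, hs0, hspi, hsg, -⟩ := hSU z hz
    obtain ⟨y, hy, hyz⟩ := hKm ⟨S z, ⟨hs.le, hs0.le, hspi.le, hge⟩, hsg⟩
    have hy' : m < y.im := hy
    rw [hg.bijOn.injOn (show (0 : ℝ) < y.im from hm.trans hy) hz.1 hyz] at hy'
    linarith

/-! ### The asymptotics of the conformal map. -/

theorem theorem1 (D : Set ℂ) (hD_open : IsOpen D) (hD_sc : IsSimplyConnected D)
    (a : ℝ) (c : ℕ → ℕ → ℝ) (hadm : IsAdmissible a c)
    (ε : ℝ) (hε : 0 < ε) (hcusp : HasCuspAtZero D a c ε)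
    (g : ℂ → ℂ) (hg : IsConformalMapOnto g {z : ℂ | 0 < z.im} D)
    (hg0 : Filter.Tendsto g (nhdsWithin 0 {z : ℂ | 0 < z.im}) (nhds 0)) :
    Filter.Tendsto
      (fun z : ℂ => g z * (((-(2 * Real.pi) / (a * Real.log ‖z‖) : ℝ) : ℂ))⁻¹)
      (nhdsWithin 0 {z : ℂ | 0 < z.im}) (nhds 1) := by
  have ha := hadm.a_pos
  have ha' : (a : ℂ) ≠ 0 := by exact_mod_cast ha.ne'
  have hpi : (Real.pi : ℂ) ≠ 0 := by exact_mod_cast Real.pi_ne_zero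
  obtain ⟨H, R, B, h, hf⟩ := hadm.exists_chart
  obtain ⟨S, r, hr, hSd, hS, hSbot, hSim⟩ :=
    hg.exists_log_factor hg0 hcusp hD_open hε ha h hf
  have hU : {z : ℂ | 0 < z.im} ∩ Metric.ball 0 r ∈ 𝓝[{z : ℂ | 0 < z.im}] 0 :=
    inter_mem self_mem_nhdsWithin (mem_nhdsWithin_of_mem_nhds (Metric.ball_mem_nhds 0 hr))
  have hNe : (𝓝[{z : ℂ | 0 < z.im}] (0 : ℂ)).NeBot := by
    rw [← mem_closure_iff_nhdsWithin_neBot, closure_setOfPred_lt_im]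
    simp
  obtain ⟨Ψ, hΨd, hΨ⟩ := exists_differentiableOn_ball_of_tendsto_im (ψ := fun z => exp (S z))
    (M := 1) hSd.cexp (fun z hz => by
      rw [norm_exp, Real.exp_le_one_iff]
      linarith [(hS z hz).1, h.pos, h.lt]) hSim
  have hΨan : AnalyticAt ℂ Ψ 0 := hΨd.analyticAt (Metric.ball_mem_nhds 0 hr)
  have hΨ0 : Ψ 0 = 0 := by
    refine tendsto_nhds_unique (hΨan.continuousAt.tendsto.mono_left nhdsWithin_le_nhds)
      (Tendsto.congr' ?_ (tendsto_exp_nhds_zero_iff.2 hSbot))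
    filter_upwards [hU] with z hz using (hΨ z hz).symm
  obtain ⟨k, hkc, hk0, hk⟩ := exists_eq_mul_of_im_pos hΨan hΨ0 (by
    filter_upwards [hU] with z hz
    obtain ⟨-, h1, h2, -⟩ := hS z hz
    rw [hΨ z hz, exp_im]
    exact mul_pos (Real.exp_pos _) (Real.sin_pos_of_pos_of_lt_pi h1 h2))
  have hlogk : ∀ᶠ z in 𝓝 (0 : ℂ), k z ≠ 0 ∧ |Real.log ‖k z‖| < |Real.log ‖k 0‖| + 1 := by
    have : ContinuousAt (fun z => |Real.log ‖k z‖|) 0 :=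
      (hkc.norm.log (norm_ne_zero_iff.2 hk0)).abs
    exact (hkc.eventually_ne hk0).and (this.eventually_lt continuousAt_const (lt_add_one _))
  have hlogz : Tendsto (fun z : ℂ => Real.log ‖z‖) (𝓝[{z : ℂ | 0 < z.im}] 0) atBot := by
    refine Real.tendsto_log_nhdsGT_zero.comp ?_
    exact (tendsto_norm_nhdsNE_zero (E := ℂ)).mono_left
      (nhdsWithin_mono _ fun z hz h0 => by simp [show z = 0 from h0] at hz)
  have hlim : Tendsto (fun z => H (S z) / (Real.log ‖z‖ : ℂ)) (𝓝[{z : ℂ | 0 < z.im}] 0) (𝓝 1) := by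
    rw [tendsto_iff_norm_sub_tendsto_zero]
    have hb : Tendsto (fun z : ℂ => (B + Real.pi + (|Real.log ‖k 0‖| + 1)) / |Real.log ‖z‖|)
        (𝓝[{z : ℂ | 0 < z.im}] 0) (𝓝 0) :=
      tendsto_const_nhds.div_atTop (tendsto_abs_atBot_atTop.comp hlogz)
    refine squeeze_zero' (Eventually.of_forall fun _ => norm_nonneg _) ?_ hb
    filter_upwards [hU, hk.filter_mono nhdsWithin_le_nhds, hlogk.filter_mono nhdsWithin_le_nhds,
      hlogz.eventually_lt_atBot 0] with z hz hkz hlk hlz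
    obtain ⟨h1, h2, h3, -⟩ := hS z hz
    have hz0 : z ≠ 0 := fun h0 => by simp [h0] at hz
    have hre : (S z).re = Real.log ‖z‖ + Real.log ‖k z‖ := by
      rw [← Real.log_mul (norm_ne_zero_iff.2 hz0) (norm_ne_zero_iff.2 hlk.1), ← norm_mul, ← hkz,
        hΨ z hz, norm_exp, Real.log_exp]
    have hl0 : (Real.log ‖z‖ : ℂ) ≠ 0 := by exact_mod_cast hlz.ne
    rw [show H (S z) / (Real.log ‖z‖ : ℂ) - 1 =
      (H (S z) - Real.log ‖z‖) / (Real.log ‖z‖ : ℂ) by field_simp, norm_div, norm_real,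
      Real.norm_eq_abs]
    gcongr
    -- All three summands are bounded: by `B`, by `π`, and by continuity of `log ‖k z‖` at `0`.
    have hsplit : H (S z) - Real.log ‖z‖ =
        (H (S z) - S z) + (S z).im * I + (Real.log ‖k z‖ : ℂ) := by
      have := re_add_im (S z)
      rw [hre] at this
      push_cast at this
      linear_combination -this
    rw [hsplit]
    refine (norm_add₃_le).trans ?_
    rw [norm_mul, norm_I, mul_one, norm_real, norm_real, Real.norm_eq_abs, Real.norm_eq_abs,
      abs_of_pos h2]
    linarith [h.norm_sub_le _ h1, hlk.2]
  have hinv := hlim.inv₀ one_ne_zero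
  rw [inv_one] at hinv
  refine hinv.congr' ?_
  filter_upwards [hU, hlogz.eventually_lt_atBot 0] with z hz hlz
  obtain ⟨h1, -, -, h4⟩ := hS z hz
  have hl0 : (Real.log ‖z‖ : ℂ) ≠ 0 := by exact_mod_cast hlz.ne
  have hH := h.ne_zero h1
  rw [← h4, cuspMap]
  push_cast
  field_simp
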